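/- All graphs are finite and simple. **Independence coloring game.** Alice and Bob play on a graph $G$ in rounds $1,2,\dots$. In round $i$ the players alternately select a not yet colored vertex and give it color $i$, so that the vertices colored $i$ always form an independent set; a round ends when no uncolored vertex can be given color $i$, and the game ends when all vertices are colored. Alice wants to minimize the number of rounds, Bob wants to maximize it. In the A-version (B-version) Alice (Bob) starts every round. In the AB-version (BA-version) Alice (Bob) starts the first round, and each further round is started by the player who did not end the previous round. The numbers of rounds under optimal play are denoted $\chi_{ig}^{A}(G)$, $\chi_{ig}^{B}(G)$, $\chi_{ig}^{AB}(G)$, $\chi_{ig}^{BA}(G)$. **Game coloring number.** In the marking game on $G$, Alice and Bob alternately mark an unmarked vertex of $G$, Alice moving first, until all vertices are marked. The game coloring number $\mathrm{col}_g(G)$ is the smallest positive integer $k$ for which Alice can prevent that at any step of the game an unmarked vertex has $k$ marked neighbors. **Theorem.** For every positive integer $k$ there exists a graph $G$, which can be chosen to be a tree, such that $$\chi_{ig}^{X}(G)-\mathrm{col}_g(G)\ge k\qquad\text{for every } X\in\{A,B,AB,BA\}.$$ -/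

import Mathlib

/-- The two players. -/
inductive Player
  | alice
  | bob

/-- The opponent of a player. -/
def Player.other : Player → Player
  | .alice => .bob
  | .bob => .alice

/-! ### The independence coloring game -/

/-- The four versions of the independence coloring game. In versions `A` and `B` every round is
started by Alice, respectively by Bob. In version `AB` (respectively `BA`) Alice (respectively Bob)
starts the first round, and each further round is started by the player who did not end the
previous round. -/
inductive IndepGameVersion
  | A
  | B
  | AB
  | BA

/-- The player who starts the first round. -/
def IndepGameVersion.firstPlayer : IndepGameVersion → Player
  | .A => .alice
  | .B => .bob
  | .AB => .alice
  | .BA => .bob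

/-- The player who starts the next round, when the player who did not end the previous round
is `p`. -/
def IndepGameVersion.nextStarter : IndepGameVersion → Player → Player
  | .A, _ => .alice
  | .B, _ => .bob
  | .AB, p => p
  | .BA, p => p

section IndepGame

variable {V : Type*} [DecidableEq V] (G : SimpleGraph V) [DecidableRel G.Adj]

/-- The legal moves when `U` is the set of uncolored vertices and `C` is the set of vertices chosen
so far in the current round: the uncolored vertices that have no neighbor in `C`. -/
def indepMoves (U C : Finset V) : Finset V :=
  U.filter fun v => ∀ w ∈ C, ¬ G.Adj v w

/-- The number of rounds that will still be started (not counting the current one) when both players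
play optimally, Alice minimizing and Bob maximizing the number of rounds, from the position in which
`U` is the set of uncolored vertices, `C` is the set of vertices chosen so far in the current round,
and `p` is the player to move. A round ends when there is no legal move; the game ends when all
vertices are colored. -/
def indepFurtherRounds (ver : IndepGameVersion) (U C : Finset V) (p : Player) : ℕ :=
  if hU : U = ∅ then 0
  else if hM : (indepMoves G U C).Nonempty then
    match p with
    | .alice => (indepMoves G U C).attach.inf' (Finset.attach_nonempty_iff.mpr hM) fun v =>
        indepFurtherRounds ver (U.erase v.1) (insert v.1 C) .bob
    | .bob => (indepMoves G U C).attach.sup' (Finset.attach_nonempty_iff.mpr hM) fun v =>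
        indepFurtherRounds ver (U.erase v.1) (insert v.1 C) .alice
  else indepFurtherRounds ver U ∅ (ver.nextStarter p) + 1
termination_by (U.card, C.card)
decreasing_by
  · exact Prod.Lex.left _ _ (Finset.card_erase_lt_of_mem (Finset.mem_filter.mp v.2).1)
  · exact Prod.Lex.left _ _ (Finset.card_erase_lt_of_mem (Finset.mem_filter.mp v.2).1)
  · refine Prod.Lex.right _ ?_
    rw [Finset.card_empty, Finset.card_pos, Finset.nonempty_iff_ne_empty]
    rintro rfl
    apply hM
    simpa [indepMoves, Finset.nonempty_iff_ne_empty] using hU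

/-- The independence game chromatic number of a finite graph, in the given version of the game:
the total number of rounds when both players play optimally. -/
def indepGameChromaticNumber [Fintype V] (ver : IndepGameVersion) : ℕ :=
  if (Finset.univ : Finset V) = ∅ then 0
  else indepFurtherRounds G ver Finset.univ ∅ ver.firstPlayer + 1

end IndepGame

/-! ### The marking game -/

section MarkingGame

variable {V : Type*} [Fintype V] [DecidableEq V] (G : SimpleGraph V) [DecidableRel G.Adj]

/-- When `S` is the set of marked vertices, no unmarked vertex has `k` (or more) marked
neighbors. -/
def MarkingSafe (k : ℕ) (S : Finset V) : Prop :=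
  ∀ v, v ∉ S → (S.filter fun w => G.Adj v w).card < k

/-- `MarkingAlicePrevents G k p S`: in the marking game, from the position in which `S` is the set
of marked vertices and `p` is the player to move, Alice can prevent that, now or at any later step
of the game, an unmarked vertex has `k` marked neighbors. -/
inductive MarkingAlicePrevents (k : ℕ) : Player → Finset V → Prop
  | finished (p : Player) : MarkingAlicePrevents k p Finset.univ
  | aliceMove (S : Finset V) (hS : MarkingSafe G k S) (v : V) (hv : v ∉ S)
      (h : MarkingAlicePrevents k .bob (insert v S)) : MarkingAlicePrevents k .alice S
  | bobMove (S : Finset V) (hS : MarkingSafe G k S)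
      (h : ∀ v, v ∉ S → MarkingAlicePrevents k .alice (insert v S)) :
      MarkingAlicePrevents k .bob S

/-- The game coloring number of a finite graph: the smallest positive integer `k` for which Alice,
moving first, can prevent in any step of the marking game that an unmarked vertex has `k` marked
neighbors. -/
noncomputable def gameColoringNumber : ℕ :=
  sInf {k : ℕ | 0 < k ∧ MarkingAlicePrevents G k .alice ∅}

/-- The set whose minimum is the game coloring number is nonempty. -/
theorem gameColoringNumber_set_nonempty :
    {k : ℕ | 0 < k ∧ MarkingAlicePrevents G k .alice ∅}.Nonempty := by
  refine ⟨Fintype.card V + 1, Nat.succ_pos _, ?_⟩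
  have safe : ∀ S : Finset V, MarkingSafe G (Fintype.card V + 1) S := fun S v _ =>
    Nat.lt_succ_of_le (Finset.card_le_univ _)
  suffices H : ∀ (n : ℕ) (S : Finset V) (p : Player), Sᶜ.card = n →
      MarkingAlicePrevents G (Fintype.card V + 1) p S from H _ _ _ rfl
  intro n
  induction n with
  | zero =>
    intro S p h
    obtain rfl : S = Finset.univ := by simpa using h
    exact .finished p
  | succ n ih =>
    intro S p h
    have step : ∀ v, v ∉ S → (insert v S)ᶜ.card = n := fun v hv => by
      rw [Finset.compl_insert, Finset.card_erase_of_mem (by simpa using hv), h]; rfl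
    cases p with
    | alice =>
      obtain ⟨v, hv⟩ : Sᶜ.Nonempty := Finset.card_pos.mp (by omega)
      have hv' : v ∉ S := by simpa using hv
      exact .aliceMove S (safe S) v hv' (ih _ _ (step v hv'))
    | bob => exact .bobMove S (safe S) fun v hv => ih _ _ (step v hv)

end MarkingGame

/-!
The graph is a complete `N`-ary rooted tree of depth `k + 4`, with `N` huge.

*Marking game.* On every rooted tree Alice keeps the number of marked neighbors of an unmarked
vertex below `4`. Call a vertex active if its subtree contains a marked vertex. Alice maintains that
after her move every unmarked vertex has at most one active child. A move `b` of Bob activates only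
vertices on the path from `b` to the root, so it gives at most one unmarked vertex a second active
child, namely the lowest vertex of this path that was active before (`branching_unique`); Alice
marks that vertex (`exists_alice_mark`). So an unmarked vertex never has marked neighbors other than
its parent and two of its children.

*Independence coloring game.* Bob makes a subtree with large branching survive each round, with one
level lost per round. A vertex is secured if a neighbor of it has been chosen in the current round;
it then survives the round. If no vertex of the subtree at `w` has been chosen yet, Bob can secure
`w` by choosing a child of `w` (`forces_secured`). He secures an `n'`-ary tree in this way, from the
top downwards. The number of moves this takes depends only on `n'` and the depth; so if the tree
that survived the preceding rounds is `n`-ary, where `n` exceeds twice this number by enough, then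
each vertex always has a further child whose subtree neither player has touched (`forces_fertile`).
Since every vertex is secured through one of its children, the deepest level is lost. Vertices
outside the secured tree may or may not survive, and this has no influence on the argument.
Iterating gives as many rounds as the tree has levels below its root (`exists_branching`).
-/

/-! ### The complete rooted tree -/

/-- The vertices of the complete `N`-ary rooted tree of depth `D`: words of length at most `D` over
an alphabet of size `N`. The empty word is the root, and the parent of `a :: l` is `l`. -/
abbrev NaryVertex (N D : ℕ) : Type := {l : List (Fin N) // l.length ≤ D}

namespace NaryVertex

variable {N D : ℕ}

instance : Finite (NaryVertex N D) := (List.finite_length_le (Fin N) D).to_subtype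

noncomputable instance : Fintype (NaryVertex N D) := Fintype.ofFinite _

/-- The root of the tree. -/
def root : NaryVertex N D := ⟨[], Nat.zero_le _⟩

/-- `IsChild v w` means that `w` is a child of `v`. -/
def IsChild (v w : NaryVertex N D) : Prop := ∃ a, w.1 = a :: v.1

/-- `Below v w` means that `w` lies in the subtree rooted at `v`; this includes `w = v`. -/
def Below (v w : NaryVertex N D) : Prop := v.1 <:+ w.1

lemma IsChild.length {v w : NaryVertex N D} (h : IsChild v w) :
    w.1.length = v.1.length + 1 := by
  obtain ⟨a, h⟩ := h
  simp [h]

lemma IsChild.below {v w : NaryVertex N D} (h : IsChild v w) : Below v w := by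
  obtain ⟨a, h⟩ := h
  exact ⟨[a], h.symm⟩

lemma IsChild.parent_unique {u v w : NaryVertex N D} (hu : IsChild u w) (hv : IsChild v w) :
    u = v := by
  obtain ⟨a, hu⟩ := hu
  obtain ⟨b, hv⟩ := hv
  rw [hu] at hv
  exact Subtype.ext (List.cons.inj hv).2

lemma Below.refl (v : NaryVertex N D) : Below v v := List.suffix_refl _

lemma Below.trans {u v w : NaryVertex N D} (h : Below u v) (h' : Below v w) : Below u w :=
  List.IsSuffix.trans h h'

lemma Below.total {u v w : NaryVertex N D} (hu : Below u w) (hv : Below v w) :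
    Below u v ∨ Below v u :=
  List.suffix_or_suffix_of_suffix hu hv

lemma Below.eq_of_length {u v w : NaryVertex N D} (hu : Below u w) (hv : Below v w)
    (h : u.1.length = v.1.length) : u = v := by
  rcases hu.total hv with h' | h'
  · exact Subtype.ext (List.IsSuffix.eq_of_length h' h)
  · exact (Subtype.ext (List.IsSuffix.eq_of_length h' h.symm)).symm

/-- Two children of the same vertex with a common descendant coincide. -/
lemma IsChild.eq_of_below {v w w' x : NaryVertex N D} (h : IsChild v w) (h' : IsChild v w')
    (hx : Below w x) (hx' : Below w' x) : w = w' :=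
  hx.eq_of_length hx' (by rw [h.length, h'.length])

lemma exists_parent {w : NaryVertex N D} (h : w ≠ root) : ∃ v, IsChild v w := by
  obtain ⟨l, hl⟩ := w
  cases l with
  | nil => exact absurd rfl h
  | cons a l => exact ⟨⟨l, (Nat.le_succ _).trans hl⟩, a, rfl⟩

end NaryVertex

open NaryVertex

/-- The complete `N`-ary tree of depth `D`. -/
def naryTree (N D : ℕ) : SimpleGraph (NaryVertex N D) where
  Adj v w := IsChild v w ∨ IsChild w v
  symm := ⟨fun _ _ h => h.symm⟩
  loopless := ⟨fun v h => by
    have := (or_self_iff.mp h).length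
    omega⟩

noncomputable instance (N D : ℕ) : DecidableRel (naryTree N D).Adj := Classical.decRel _

theorem naryTree_connected (N D : ℕ) : (naryTree N D).Connected := by
  have reach : ∀ (n : ℕ) (v : NaryVertex N D), v.1.length = n →
      (naryTree N D).Reachable root v := by
    intro n
    induction n with
    | zero =>
      intro v hv
      rw [show v = root from Subtype.ext (List.length_eq_zero_iff.mp hv)]
    | succ n ih =>
      intro v hv
      obtain ⟨u, hu⟩ := exists_parent (w := v) (by rintro rfl; simp [root] at hv)
      have hlen := hu.length
      exact (ih u (by omega)).trans (SimpleGraph.Adj.reachable (Or.inl hu))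
  have : Nonempty (NaryVertex N D) := ⟨root⟩
  exact ⟨fun u v => (reach _ u rfl).symm.trans (reach _ v rfl)⟩

theorem naryTree_isTree (N D : ℕ) : (naryTree N D).IsTree := by
  rw [SimpleGraph.isTree_iff_connected_and_card]
  have hconn := naryTree_connected N D
  refine ⟨hconn, le_antisymm ?_ hconn.card_vert_le_card_edgeSet_add_one⟩
  -- The vertices other than the root map onto the edges, each going to the edge to its parent.
  have hpar : ∀ w : {w : NaryVertex N D // w ≠ root}, ∃ v, IsChild v w.1 :=
    fun w => exists_parent w.2
  choose par hpar using hpar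
  let f : {w : NaryVertex N D // w ≠ root} → (naryTree N D).edgeSet :=
    fun w => ⟨s(par w, w.1), Or.inl (hpar w)⟩
  have hf : Function.Surjective f := by
    have key : ∀ v w : NaryVertex N D, IsChild v w →
        ∃ x, (f x : Sym2 (NaryVertex N D)) = s(v, w) := by
      intro v w h
      have hw : w ≠ root := by
        rintro rfl
        simpa [root] using h.length
      exact ⟨⟨w, hw⟩, by simp only [f]; rw [(hpar ⟨w, hw⟩).parent_unique h]⟩
    rintro ⟨e, he⟩
    induction e using Sym2.ind with
    | _ v w =>
      rcases he with h | h
      · obtain ⟨x, hx⟩ := key v w h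
        exact ⟨x, Subtype.ext hx⟩
      · obtain ⟨x, hx⟩ := key w v h
        exact ⟨x, Subtype.ext (hx.trans Sym2.eq_swap)⟩
  have hcard := Nat.card_le_card_of_surjective f hf
  have hsub : Nat.card {w : NaryVertex N D // w ≠ root} < Nat.card (NaryVertex N D) := by
    rw [Nat.card_eq_fintype_card, Nat.card_eq_fintype_card]
    exact Fintype.card_subtype_lt (x := root) (by simp)
  omega

/-! ### The marking game on the complete tree -/

section Marking

variable {N D : ℕ}

/-- `Active S v` means that the subtree rooted at `v` contains a marked vertex, where `S` is the set
of marked vertices. -/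
def Active (S : Finset (NaryVertex N D)) (v : NaryVertex N D) : Prop := ∃ s ∈ S, Below v s

/-- At most one child of `v` is active. -/
def AtMostOneActiveChild (S : Finset (NaryVertex N D)) (v : NaryVertex N D) : Prop :=
  ∀ c c', IsChild v c → IsChild v c' → Active S c → Active S c' → c = c'

lemma Active.mono_below {S : Finset (NaryVertex N D)} {u v : NaryVertex N D} (h : Active S v)
    (huv : Below u v) : Active S u := by
  obtain ⟨s, hs, hb⟩ := h
  exact ⟨s, hs, huv.trans hb⟩

lemma active_insert {S : Finset (NaryVertex N D)} {b v : NaryVertex N D} :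
    Active (insert b S) v ↔ Below v b ∨ Active S v := by
  simp [Active]

/-- Marking an active vertex makes no new vertex active. -/
lemma active_insert_of_active {S : Finset (NaryVertex N D)} {b v : NaryVertex N D}
    (hb : Active S b) : Active (insert b S) v ↔ Active S v := by
  rw [active_insert, or_iff_right_iff_imp]
  exact hb.mono_below

/-- The marked neighbors of a vertex are among its parent and its active children, so two active
children at each unmarked vertex are harmless. -/
lemma markingSafe_of_active {S : Finset (NaryVertex N D)}
    (h : ∀ v ∉ S, ∃ c c', ∀ d, IsChild v d → Active S d → d = c ∨ d = c') :
    MarkingSafe (naryTree N D) 4 S := by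
  intro v hv
  obtain ⟨c, c', hc⟩ := h v hv
  have hpar : ∃ p : NaryVertex N D, ∀ q, IsChild q v → q = p := by
    by_cases hp : ∃ p, IsChild p v
    · obtain ⟨p, hp⟩ := hp
      exact ⟨p, fun q hq => hq.parent_unique hp⟩
    · exact ⟨v, fun q hq => absurd ⟨q, hq⟩ hp⟩
  obtain ⟨p, hp⟩ := hpar
  have hsub : (S.filter fun w => (naryTree N D).Adj v w) ⊆ {p, c, c'} := by
    intro w hw
    obtain ⟨hwS, hw | hw⟩ := Finset.mem_filter.mp hw
    · rcases hc w hw ⟨w, hwS, Below.refl w⟩ with rfl | rfl <;> simp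
    · simp [hp w hw]
  exact (Finset.card_le_card hsub).trans_lt (Finset.card_le_three.trans_lt (by norm_num))

/-- After a move of Bob at most two children of an unmarked vertex are active. -/
lemma two_active_children {S : Finset (NaryVertex N D)} {b v : NaryVertex N D}
    (h : AtMostOneActiveChild S v) :
    ∃ c c', ∀ d, IsChild v d → Active (insert b S) d → d = c ∨ d = c' := by
  have h₁ : ∃ c, ∀ d, IsChild v d → Active S d → d = c := by
    by_cases hc : ∃ c, IsChild v c ∧ Active S c
    · obtain ⟨c, hc, hc'⟩ := hc
      exact ⟨c, fun d hd hd' => h d c hd hc hd' hc'⟩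
    · exact ⟨v, fun d hd hd' => absurd ⟨d, hd, hd'⟩ hc⟩
  have h₂ : ∃ c, ∀ d, IsChild v d → Below d b → d = c := by
    by_cases hc : ∃ c, IsChild v c ∧ Below c b
    · obtain ⟨c, hc, hc'⟩ := hc
      exact ⟨c, fun d hd hd' => hd.eq_of_below hc hd' hc'⟩
    · exact ⟨v, fun d hd hd' => absurd ⟨d, hd, hd'⟩ hc⟩
  obtain ⟨c, hc⟩ := h₁
  obtain ⟨c', hc'⟩ := h₂
  refine ⟨c, c', fun d hd ha => ?_⟩
  rcases active_insert.mp ha with ha | ha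
  · exact Or.inr (hc' d hd ha)
  · exact Or.inl (hc d hd ha)

/-- If a move `b` of Bob gives `v` a second active child, then `v` was active, and the path from `b`
up to `v` enters `v` through a child that was not active. -/
lemma branching_of_not_atMostOne {S : Finset (NaryVertex N D)} {b v : NaryVertex N D}
    (h : AtMostOneActiveChild S v) (h' : ¬ AtMostOneActiveChild (insert b S) v) :
    Active S v ∧ ∃ c, IsChild v c ∧ Below c b ∧ ¬ Active S c := by
  simp only [AtMostOneActiveChild, not_forall] at h'
  obtain ⟨c, c', hc, hc', ha, ha', hne⟩ := h'
  rcases active_insert.mp ha with hb | ha₁ <;> rcases active_insert.mp ha' with hb' | ha₁'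
  · exact absurd (hc.eq_of_below hc' hb hb') hne
  · exact ⟨ha₁'.mono_below hc'.below, c, hc, hb, fun hs => hne (h c c' hc hc' hs ha₁')⟩
  · exact ⟨ha₁.mono_below hc.below, c', hc', hb', fun hs => hne (h c c' hc hc' ha₁ hs)⟩
  · exact absurd (h c c' hc hc' ha₁ ha₁') hne

/-- A move of Bob gives at most one unmarked vertex a second active child: the lowest vertex on the
path from `b` to the root that was already active. -/
lemma branching_unique {S : Finset (NaryVertex N D)} {b v v' : NaryVertex N D}
    (hv : AtMostOneActiveChild S v) (hv' : AtMostOneActiveChild S v')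
    (hn : ¬ AtMostOneActiveChild (insert b S) v) (hn' : ¬ AtMostOneActiveChild (insert b S) v') :
    v = v' := by
  obtain ⟨ha, c, hc, hcb, hca⟩ := branching_of_not_atMostOne hv hn
  obtain ⟨ha', c', hc', hcb', hca'⟩ := branching_of_not_atMostOne hv' hn'
  have hle : ∀ {u u' d : NaryVertex N D}, IsChild u d → Below d b → Active S u' → ¬ Active S d →
      Below u' b → u'.1.length ≤ u.1.length := by
    intro u u' d hd hdb hau had hub
    by_contra hlt
    have hlen := hd.length
    rcases hdb.total hub with h | h
    · exact had (hau.mono_below h)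
    · have := List.IsSuffix.length_le h
      have heq : d = u' := hdb.eq_of_length hub (by omega)
      exact had (heq ▸ hau)
  have hvb := hc.below.trans hcb
  have hvb' := hc'.below.trans hcb'
  exact hvb.eq_of_length hvb' (le_antisymm (hle hc' hcb' ha hca' hvb) (hle hc hcb ha' hca hvb'))

/-- Alice can always move so that every unmarked vertex has at most one active child, as long as at
most one vertex violates this beforehand. -/
lemma exists_alice_mark {S : Finset (NaryVertex N D)} (hS : S ≠ Finset.univ)
    (h : ∀ v ∉ S, ∀ v' ∉ S, ¬ AtMostOneActiveChild S v → ¬ AtMostOneActiveChild S v' → v = v') :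
    ∃ x ∉ S, ∀ v ∉ insert x S, AtMostOneActiveChild (insert x S) v := by
  have mark_active : ∀ x, Active S x → (∀ v ∉ insert x S, AtMostOneActiveChild S v) →
      ∀ v ∉ insert x S, AtMostOneActiveChild (insert x S) v := by
    intro x hx hI v hv c c' hc hc' ha ha'
    rw [active_insert_of_active hx] at ha ha'
    exact hI v hv c c' hc hc' ha ha'
  by_cases hbad : ∃ x ∉ S, ¬ AtMostOneActiveChild S x
  · obtain ⟨x, hx, hxb⟩ := hbad
    refine ⟨x, hx, mark_active x ?_ fun v hv => ?_⟩
    · simp only [AtMostOneActiveChild, not_forall] at hxb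
      obtain ⟨c, c', hc, -, ha, -⟩ := hxb
      exact ha.mono_below hc.below
    · rw [Finset.mem_insert, not_or] at hv
      by_contra hvb
      exact hv.1 (h v hv.2 x hx hvb hxb)
  push Not at hbad
  by_cases hact : ∃ x ∉ S, Active S x
  · obtain ⟨x, hx, hxa⟩ := hact
    exact ⟨x, hx, mark_active x hxa fun v hv => hbad v fun hvS => hv (Finset.mem_insert_of_mem hvS)⟩
  push Not at hact
  -- The marked vertices are closed under taking parents; an unmarked vertex of least depth keeps
  -- this.
  have hne : Sᶜ.Nonempty := by
    rwa [Finset.nonempty_iff_ne_empty, Ne, Finset.compl_eq_empty_iff]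
  obtain ⟨x, hx, hmin⟩ := Finset.exists_min_image Sᶜ (fun v => v.1.length) hne
  refine ⟨x, by simpa using hx, fun v hv c c' hc _ ha _ => ?_⟩
  rw [Finset.mem_insert, not_or] at hv
  rcases active_insert.mp ha with hb | ha
  · have h₁ := hmin v (by simpa using hv.2)
    have h₂ := hc.length
    have h₃ := List.IsSuffix.length_le hb
    omega
  · exact absurd (ha.mono_below hc.below) (hact v hv.2)

/-- Alice wins the marking game on the complete tree with bound `4`. -/
theorem naryTree_marking (N D : ℕ) : MarkingAlicePrevents (naryTree N D) 4 .alice ∅ := by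
  suffices H : ∀ (n : ℕ) (S : Finset (NaryVertex N D)), Sᶜ.card = n →
      (∀ v ∉ S, ∃ c c', ∀ d, IsChild v d → Active S d → d = c ∨ d = c') →
      (∀ v ∉ S, ∀ v' ∉ S, ¬ AtMostOneActiveChild S v → ¬ AtMostOneActiveChild S v' → v = v') →
      MarkingAlicePrevents (naryTree N D) 4 .alice S by
    have hempty : ∀ v : NaryVertex N D, ¬ Active ∅ v := by simp [Active]
    refine H _ ∅ rfl (fun v _ => ⟨v, v, fun d _ hd => absurd hd (hempty d)⟩) ?_
    exact fun v _ _ _ hn => absurd (fun c _ _ _ hc => absurd hc (hempty c)) hn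
  intro n
  induction n using Nat.strong_induction_on with
  | _ n ih =>
    intro S hn htwo hone
    by_cases hS : S = Finset.univ
    · exact hS ▸ .finished _
    obtain ⟨x, hx, hinv⟩ := exists_alice_mark hS hone
    refine .aliceMove S (markingSafe_of_active htwo) x hx (.bobMove _ ?_ fun b hb => ?_)
    · -- One active child is a special case of two: repeat the last move.
      refine markingSafe_of_active fun v hv => ?_
      have hxx : insert x S = insert x (insert x S) := by simp
      rw [hxx]
      exact two_active_children (hinv v hv)
    · refine ih _ ?_ _ rfl (fun v hv => ?_) fun v hv v' hv' => ?_
      · rw [← hn]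
        refine Finset.card_lt_card (Finset.compl_ssubset_compl.mpr ?_)
        exact (Finset.ssubset_insert hx).trans (Finset.ssubset_insert hb)
      · exact two_active_children (hinv v fun h => hv (Finset.mem_insert_of_mem h))
      · exact branching_unique (hinv v fun h => hv (Finset.mem_insert_of_mem h))
          (hinv v' fun h => hv' (Finset.mem_insert_of_mem h))

theorem gameColoringNumber_naryTree_le (N D : ℕ) : gameColoringNumber (naryTree N D) ≤ 4 :=
  Nat.sInf_le ⟨by norm_num, naryTree_marking N D⟩

end Marking

/-! ### Forcing within a round -/

section Forcing

variable {V : Type*} (G : SimpleGraph V) [DecidableRel G.Adj]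

lemma mem_indepMoves {U C : Finset V} {x : V} :
    x ∈ indepMoves G U C ↔ x ∈ U ∧ ∀ w ∈ C, ¬ G.Adj x w := by
  simp [indepMoves]

/-- The uncolored vertices with a neighbor chosen in the current round. They stay uncolored until
the end of the round. -/
def secured (U C : Finset V) : Finset V := U.filter fun w => ∃ c ∈ C, G.Adj w c

lemma mem_secured {U C : Finset V} {w : V} :
    w ∈ secured G U C ↔ w ∈ U ∧ ∃ c ∈ C, G.Adj w c := by
  simp [secured]

variable [DecidableEq V]

/-- Bob wants many rounds: on his turn one good legal move suffices. -/
lemma le_indepFurtherRounds_bob {ver : IndepGameVersion} {U C : Finset V} {s : ℕ} {x : V}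
    (hx : x ∈ indepMoves G U C)
    (h : s ≤ indepFurtherRounds G ver (U.erase x) (insert x C) .alice) :
    s ≤ indepFurtherRounds G ver U C .bob := by
  have hU : U ≠ ∅ := Finset.ne_empty_of_mem ((mem_indepMoves G).mp hx).1
  rw [indepFurtherRounds, dif_neg hU, dif_pos ⟨x, hx⟩]
  exact h.trans (Finset.le_sup' (fun v : {v // v ∈ indepMoves G U C} =>
    indepFurtherRounds G ver (U.erase v.1) (insert v.1 C) .alice) (Finset.mem_attach _ ⟨x, hx⟩))

/-- On Alice's turn all legal moves have to be good for Bob. -/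
lemma le_indepFurtherRounds_alice {ver : IndepGameVersion} {U C : Finset V} {s : ℕ}
    (hne : (indepMoves G U C).Nonempty)
    (h : ∀ x ∈ indepMoves G U C, s ≤ indepFurtherRounds G ver (U.erase x) (insert x C) .bob) :
    s ≤ indepFurtherRounds G ver U C .alice := by
  have hU : U ≠ ∅ := Finset.ne_empty_of_mem ((mem_indepMoves G).mp hne.choose_spec).1
  rw [indepFurtherRounds, dif_neg hU, dif_pos hne]
  exact Finset.le_inf' _ _ fun v _ => h v.1 v.2

lemma indepFurtherRounds_of_not_nonempty {ver : IndepGameVersion} {U C : Finset V} {p : Player}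
    (hU : U ≠ ∅) (hne : ¬ (indepMoves G U C).Nonempty) :
    indepFurtherRounds G ver U C p = indepFurtherRounds G ver U ∅ (ver.nextStarter p) + 1 := by
  rw [indepFurtherRounds, dif_neg hU, dif_neg hne]

lemma secured_subset_of_move {U C : Finset V} {x : V} (hx : x ∈ indepMoves G U C) :
    secured G U C ⊆ secured G (U.erase x) (insert x C) := by
  intro w hw
  obtain ⟨hwU, c, hc, hadj⟩ := (mem_secured G).mp hw
  refine (mem_secured G).mpr
    ⟨Finset.mem_erase.mpr ⟨?_, hwU⟩, c, Finset.mem_insert_of_mem hc, hadj⟩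
  rintro rfl
  exact ((mem_indepMoves G).mp hx).2 c hc hadj

/-- `Forces G Q m U C`: from the position with Bob to move, he can reach a position satisfying `Q`
by exactly `m` moves, each answered by Alice, within the current round. It is required that Alice
always has a legal answer. -/
def Forces (Q : Finset V → Finset V → Prop) : ℕ → Finset V → Finset V → Prop
  | 0, U, C => Q U C
  | m + 1, U, C => ∃ x ∈ indepMoves G U C,
      (indepMoves G (U.erase x) (insert x C)).Nonempty ∧
      ∀ y ∈ indepMoves G (U.erase x) (insert x C),
        Forces Q m ((U.erase x).erase y) (insert y (insert x C))

lemma Forces.trans {Q Q' : Finset V → Finset V → Prop} {m m' : ℕ} {U C : Finset V}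
    (h : Forces G Q m U C) (h' : ∀ U' C', Q U' C' → Forces G Q' m' U' C') :
    Forces G Q' (m + m') U C := by
  induction m generalizing U C with
  | zero => rw [zero_add]; exact h' U C h
  | succ m ih =>
    obtain ⟨x, hx, hne, hy⟩ := h
    rw [Nat.succ_add]
    exact ⟨x, hx, hne, fun y hy' => ih (hy y hy')⟩

/-- What remains true after `m` moves of each player in the same round: the set of vertices that
were uncolored when the round began is the same, at most `2 * m` more vertices are chosen, and
secured vertices are still secured. -/
structure Later (m : ℕ) (U C U' C' : Finset V) : Prop where
  union_eq : U' ∪ C' = U ∪ C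
  card_le : C'.card ≤ C.card + 2 * m
  secured_subset : secured G U C ⊆ secured G U' C'

lemma erase_union_insert {U C : Finset V} {x : V} (hx : x ∈ U) :
    U.erase x ∪ insert x C = U ∪ C := by
  ext z
  by_cases hz : z = x
  · simp [hz, hx]
  · simp [hz]

lemma Forces.later {Q : Finset V → Finset V → Prop} {m : ℕ} {U C : Finset V}
    (h : Forces G Q m U C) : Forces G (fun U' C' => Q U' C' ∧ Later G m U C U' C') m U C := by
  induction m generalizing U C with
  | zero => exact ⟨h, rfl, le_rfl, subset_rfl⟩
  | succ m ih =>
    obtain ⟨x, hx, hne, hy⟩ := h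
    refine ⟨x, hx, hne, fun y hy' => ?_⟩
    refine (ih (hy y hy')).trans G (m' := 0) fun U' C' ⟨hQ, hL⟩ => ⟨hQ, ?_, ?_, ?_⟩
    · rw [hL.union_eq, erase_union_insert ((mem_indepMoves G).mp hy').1,
        erase_union_insert ((mem_indepMoves G).mp hx).1]
    · have h₁ := hL.card_le
      have h₂ := Finset.card_insert_le y (insert x C)
      have h₃ := Finset.card_insert_le x C
      omega
    · exact ((secured_subset_of_move G hx).trans (secured_subset_of_move G hy')).trans
        hL.secured_subset

lemma Forces.le_indepFurtherRounds {Q : Finset V → Finset V → Prop} {ver : IndepGameVersion}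
    {m s : ℕ} {U C : Finset V} (h : Forces G Q m U C)
    (hQ : ∀ U' C', Q U' C' → s ≤ indepFurtherRounds G ver U' C' .bob) :
    s ≤ indepFurtherRounds G ver U C .bob := by
  induction m generalizing U C with
  | zero => exact hQ U C h
  | succ m ih =>
    obtain ⟨x, hx, hne, hy⟩ := h
    exact le_indepFurtherRounds_bob G hx
      (le_indepFurtherRounds_alice G hne fun y hy' => ih (hy y hy'))

/-- Let `R` be a monotone property of vertex sets such that a round begun with a set of uncolored
vertices satisfying `R` is followed by at least `s` rounds. If the secured vertices satisfy `R`,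
then at least `s + 1` rounds follow the current one: whatever is played, the secured vertices survive. -/
lemma succ_le_indepFurtherRounds_of_secured {ver : IndepGameVersion} {s : ℕ}
    {R : Finset V → Prop} (hmono : ∀ S S', S ⊆ S' → R S → R S') (hR : ∀ S, R S → S ≠ ∅)
    (hs : ∀ S p, R S → s ≤ indepFurtherRounds G ver S ∅ p) {U C : Finset V} (p : Player)
    (h : R (secured G U C)) : s + 1 ≤ indepFurtherRounds G ver U C p := by
  have hRU : ∀ {U C : Finset V}, R (secured G U C) → R U :=
    fun h => hmono _ _ (Finset.filter_subset _ _) h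
  have step : ∀ {U C : Finset V} {x : V}, R (secured G U C) → x ∈ indepMoves G U C →
      R (secured G (U.erase x) (insert x C)) :=
    fun h hx => hmono _ _ (secured_subset_of_move G hx) h
  induction hn : U.card using Nat.strong_induction_on generalizing U C p with
  | _ n ih =>
    by_cases hne : (indepMoves G U C).Nonempty
    · have ih' : ∀ x ∈ indepMoves G U C, ∀ q,
          s + 1 ≤ indepFurtherRounds G ver (U.erase x) (insert x C) q := fun x hx q =>
        ih _ (hn ▸ Finset.card_erase_lt_of_mem ((mem_indepMoves G).mp hx).1) q (step h hx) rfl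
      cases p with
      | alice => exact le_indepFurtherRounds_alice G hne fun x hx => ih' x hx _
      | bob =>
        obtain ⟨x, hx⟩ := hne
        exact le_indepFurtherRounds_bob G hx (ih' x hx _)
    · rw [indepFurtherRounds_of_not_nonempty G (hR _ (hRU h)) hne]
      exact Nat.succ_le_succ (hs _ _ (hRU h))

end Forcing

/-! ### Bob's strategy on the complete tree -/

section Bob

variable {N D : ℕ}

/-- `Fertile n d S v`: below `v` there is an `n`-ary tree of depth `d` with root `v`, all of whose
vertices other than `v` lie in `S`. -/
def Fertile (n : ℕ) : ℕ → Finset (NaryVertex N D) → NaryVertex N D → Prop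
  | 0, _, _ => True
  | d + 1, S, v => ∃ R : Finset (NaryVertex N D), R.card = n ∧
      ∀ w ∈ R, IsChild v w ∧ w ∈ S ∧ Fertile n d S w

lemma Fertile.mono {n d : ℕ} {S S' : Finset (NaryVertex N D)} {v : NaryVertex N D} (hS : S ⊆ S')
    (h : Fertile n d S v) : Fertile n d S' v := by
  induction d generalizing v with
  | zero => trivial
  | succ d ih =>
    obtain ⟨R, hR, h⟩ := h
    exact ⟨R, hR, fun w hw => ⟨(h w hw).1, hS (h w hw).2.1, ih (h w hw).2.2⟩⟩

lemma fertile_univ {d : ℕ} {v : NaryVertex N D} (h : v.1.length + d ≤ D) :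
    Fertile N d Finset.univ v := by
  induction d generalizing v with
  | zero => trivial
  | succ d ih =>
    have hlen : ∀ a : Fin N, (a :: v.1).length ≤ D := fun a => by
      rw [List.length_cons]; omega
    let child : Fin N ↪ NaryVertex N D :=
      ⟨fun a => ⟨a :: v.1, hlen a⟩, fun a b hab => (List.cons.inj (congrArg Subtype.val hab)).1⟩
    refine ⟨Finset.univ.map child, by simp, fun w hw => ?_⟩
    obtain ⟨a, -, rfl⟩ := Finset.mem_map.mp hw
    refine ⟨⟨a, rfl⟩, Finset.mem_univ _, ih ?_⟩
    change v.1.length + 1 + d ≤ D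
    omega

/-- Among more children of `v` than there are chosen vertices, the subtree of some child contains no
chosen vertex. -/
lemma exists_untouched {R C : Finset (NaryVertex N D)} {v : NaryVertex N D}
    (hR : ∀ w ∈ R, IsChild v w) (h : C.card < R.card) : ∃ w ∈ R, ∀ c ∈ C, ¬ Below w c := by
  by_contra! hcon
  choose! f hfC hf using hcon
  obtain ⟨w, hw, w', hw', hne, heq⟩ :=
    Finset.exists_ne_map_eq_of_card_lt_of_maps_to h (f := f) fun w hw => hfC w hw
  exact hne ((hR w hw).eq_of_below (hR w' hw') (hf w hw) (heq ▸ hf w' hw'))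

/-- A child `c` of a vertex `w` whose subtree contains no chosen vertex is a legal move. -/
lemma mem_indepMoves_of_untouched {U C : Finset (NaryVertex N D)} {w c : NaryVertex N D}
    (hw : ∀ x ∈ C, ¬ Below w x) (hc : IsChild w c) (hcU : c ∈ U ∪ C) :
    c ∈ indepMoves (naryTree N D) U C := by
  refine (mem_indepMoves _).mpr ⟨?_, fun x hx hadj => ?_⟩
  · exact (Finset.mem_union.mp hcU).resolve_right fun h => hw c h hc.below
  · rcases hadj with h | h
    · exact hw x hx (hc.below.trans h.below)
    · exact hw x hx (h.parent_unique hc ▸ Below.refl x)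

lemma indepMoves_nonempty_of_fertile {n d : ℕ} {U C : Finset (NaryVertex N D)}
    {v : NaryVertex N D} (h : Fertile n (d + 2) (U ∪ C) v) (hC : C.card < n) :
    (indepMoves (naryTree N D) U C).Nonempty := by
  obtain ⟨R, hR, h⟩ := h
  obtain ⟨w, hw, hwC⟩ := exists_untouched (fun w hw => (h w hw).1) (hR ▸ hC)
  obtain ⟨R', hR', h'⟩ := (h w hw).2.2
  obtain ⟨c, hc⟩ := Finset.card_pos.mp (hR' ▸ (Nat.zero_le _).trans_lt hC)
  exact ⟨c, mem_indepMoves_of_untouched hwC (h' c hc).1 (h' c hc).2.1⟩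

/-- The number of vertices other than the root in the `n`-ary tree of depth `d`; Bob secures each of
them by one move. -/
def bobMoves (n : ℕ) : ℕ → ℕ
  | 0 => 0
  | d + 1 => n * (1 + bobMoves n d)

/-- Bob secures a vertex `w` with untouched subtree by choosing one of its children. -/
lemma forces_secured {n d e : ℕ} {U C : Finset (NaryVertex N D)} {v w : NaryVertex N D}
    (hroot : Fertile n (e + 2) (U ∪ C) v) (hC : C.card + 1 < n) (hw : ∀ x ∈ C, ¬ Below w x)
    (hwU : w ∈ U ∪ C) (hfert : Fertile n (d + 1) (U ∪ C) w) :
    Forces (naryTree N D) (fun U' C' => w ∈ secured (naryTree N D) U' C') 1 U C := by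
  obtain ⟨R, hR, h⟩ := hfert
  obtain ⟨c, hc⟩ := Finset.card_pos.mp (hR ▸ (Nat.zero_le _).trans_lt hC)
  obtain ⟨hcw, hcU, -⟩ := h c hc
  have hmove := mem_indepMoves_of_untouched hw hcw hcU
  refine ⟨c, hmove, ?_, fun y hy => secured_subset_of_move _ hy ?_⟩
  · refine indepMoves_nonempty_of_fertile (n := n) (d := e) (v := v) ?_ ?_
    · rwa [erase_union_insert ((mem_indepMoves _).mp hmove).1]
    · exact (Finset.card_insert_le _ _).trans_lt hC
  · refine (mem_secured _).mpr ⟨Finset.mem_erase.mpr ⟨?_, ?_⟩, c, Finset.mem_insert_self _ _,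
      Or.inl hcw⟩
    · rintro rfl
      simpa using hcw.length
    · exact (Finset.mem_union.mp hwU).resolve_right fun h => hw w h (Below.refl w)

/-- If the branching `n` of the surviving tree exceeds the number of moves to be made, then Bob can
secure, below a given vertex, an `n'`-ary tree of one level less. -/
lemma forces_fertile {n n' e : ℕ} {r : NaryVertex N D} (d : ℕ)
    {U C : Finset (NaryVertex N D)} {v : NaryVertex N D}
    (hroot : Fertile n (e + 2) (U ∪ C) r) (hfert : Fertile n (d + 1) (U ∪ C) v)
    (hn : C.card + 2 * bobMoves n' d + n' < n) :
    Forces (naryTree N D) (fun U' C' => Fertile n' d (secured (naryTree N D) U' C') v)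
      (bobMoves n' d) U C := by
  induction d generalizing U C v with
  | zero => trivial
  | succ d ih =>
    -- The children are treated one after the other; each is secured first, then its subtree.
    have key : ∀ j ≤ n', Forces (naryTree N D) (fun U' C' => ∃ R : Finset (NaryVertex N D),
        R.card = j ∧ ∀ w ∈ R, IsChild v w ∧ w ∈ secured (naryTree N D) U' C' ∧
          Fertile n' d (secured (naryTree N D) U' C') w) (j * (1 + bobMoves n' d)) U C := by
      intro j
      induction j with
      | zero =>
        intro _
        rw [Nat.zero_mul]
        exact ⟨∅, rfl, by simp⟩
      | succ j ihj =>
        intro hj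
        rw [Nat.succ_mul]
        refine ((ihj (by omega)).later _).trans _ ?_
        rintro U₁ C₁ ⟨⟨R, hRj, hR⟩, hL₁⟩
        have hbound : (j + 1) * (1 + bobMoves n' d) ≤ bobMoves n' (d + 1) :=
          Nat.mul_le_mul_right _ hj
        rw [Nat.succ_mul] at hbound
        have hcard₁ := hL₁.card_le
        obtain ⟨R₀, hR₀n, hR₀⟩ := hfert
        have hsdiff := Finset.le_card_sdiff R R₀
        obtain ⟨w, hw, hwC⟩ := exists_untouched (C := C₁) (R := R₀ \ R) (v := v)
          (fun w hw => (hR₀ w (Finset.mem_sdiff.mp hw).1).1) (by omega)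
        obtain ⟨hwR₀, hwR⟩ := Finset.mem_sdiff.mp hw
        obtain ⟨hvw, hwU, hwf⟩ := hR₀ w hwR₀
        rw [← hL₁.union_eq] at hwU hwf hroot
        refine ((forces_secured hroot (by omega) hwC hwU hwf).later _).trans _ ?_
        rintro U₂ C₂ ⟨hws, hL₂⟩
        have hcard₂ := hL₂.card_le
        rw [← hL₂.union_eq] at hwf hroot
        refine ((ih hroot hwf (by omega)).later _).trans _ (m' := 0) ?_
        rintro U₃ C₃ ⟨hw₃, hL₃⟩
        refine ⟨insert w R, by rw [Finset.card_insert_of_notMem hwR, hRj], fun z hz => ?_⟩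
        rcases Finset.mem_insert.mp hz with rfl | hz
        · exact ⟨hvw, hL₃.secured_subset hws, hw₃⟩
        · have hsub := hL₂.secured_subset.trans hL₃.secured_subset
          exact ⟨(hR z hz).1, hsub (hR z hz).2.1, (hR z hz).2.2.mono hsub⟩
    exact key n' le_rfl

/-- For each `d` there is a branching `n` such that Bob can force `d` further rounds as soon as an
`n`-ary tree of depth `d + 1` survives below some vertex at the beginning of a round. -/
theorem exists_branching (d : ℕ) : ∃ n, 0 < n ∧ ∀ (N D : ℕ) (ver : IndepGameVersion)
    (r : NaryVertex N D) (U : Finset (NaryVertex N D)) (p : Player), Fertile n (d + 1) U r →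
      d ≤ indepFurtherRounds (naryTree N D) ver U ∅ p := by
  induction d with
  | zero => exact ⟨1, one_pos, fun _ _ _ _ _ _ _ => Nat.zero_le _⟩
  | succ d ih =>
    obtain ⟨n', hn', ih⟩ := ih
    -- The summand `2` makes room for an opening move of Alice.
    refine ⟨2 * bobMoves n' (d + 1) + n' + 2, by omega, fun N D ver r U p h => ?_⟩
    have hbob : ∀ U' C' : Finset (NaryVertex N D), U' ∪ C' = U → C'.card ≤ 1 →
        d + 1 ≤ indepFurtherRounds (naryTree N D) ver U' C' .bob := by
      rintro U' C' rfl hC'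
      refine (forces_fertile (n' := n') (d + 1) h h (by omega)).le_indepFurtherRounds _ ?_
      intro U₁ C₁ hf
      refine succ_le_indepFurtherRounds_of_secured _ (R := fun S => Fertile n' (d + 1) S r)
        (fun S S' hS hf => hf.mono hS) ?_ (fun S q hS => ih N D ver r S q hS) _ hf
      rintro S ⟨R, hR, hRS⟩ rfl
      obtain ⟨w, hw⟩ := Finset.card_pos.mp (hR ▸ hn')
      exact absurd (hRS w hw).2.1 (Finset.notMem_empty w)
    cases p with
    | bob => exact hbob U ∅ (Finset.union_empty U) (by simp)
    | alice =>
      refine le_indepFurtherRounds_alice _ (indepMoves_nonempty_of_fertile (v := r) (d := d)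
        (n := 2 * bobMoves n' (d + 1) + n' + 2) ?_ (by simp)) fun x hx => hbob _ _ ?_ (by simp)
      · rwa [Finset.union_empty]
      · rw [erase_union_insert ((mem_indepMoves _).mp hx).1, Finset.union_empty]

end Bob

theorem mainTheorem8 (k : ℕ) (hk : 0 < k) :
    ∃ (V : Type) (_ : Fintype V) (_ : DecidableEq V) (G : SimpleGraph V) (_ : DecidableRel G.Adj),
      G.IsTree ∧ ∀ ver : IndepGameVersion,
        (k : ℤ) ≤ (indepGameChromaticNumber G ver : ℤ) - (gameColoringNumber G : ℤ) := by
  obtain ⟨N, -, hN⟩ := exists_branching (k + 3)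
  refine ⟨NaryVertex N (k + 4), inferInstance, inferInstance, naryTree N (k + 4), inferInstance,
    naryTree_isTree N (k + 4), fun ver => ?_⟩
  have hcol := gameColoringNumber_naryTree_le N (k + 4)
  have hrounds := hN N (k + 4) ver root Finset.univ ver.firstPlayer
    (fertile_univ (by simp [root]))
  have hne : (Finset.univ : Finset (NaryVertex N (k + 4))) ≠ ∅ :=
    Finset.ne_empty_of_mem (Finset.mem_univ root)
  have hchi : k + 4 ≤ indepGameChromaticNumber (naryTree N (k + 4)) ver := by
    rw [indepGameChromaticNumber, if_neg hne]
    omega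
  omega
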